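/- Let $G$ be a finite connected bipartite plane graph with at least one edge (parallel edges allowed; only the combinatorial structure of the embedding matters, that is, the cyclic order of the edges around each vertex and the choice of the infinite face), with a fixed proper black/white colouring of its vertices, such that every edge of $G$ lies in some perfect matching; this is property $(*)$. For a non-infinite face $f$ of $G$ (its boundary is a cycle), an edge of $f$ is black-white in $f$ if, going clockwise around $f$, one meets first its black and then its white endpoint, and white-black in $f$ otherwise. If a perfect matching $M$ contains all black-white edges of $f$, the down-flip of $M$ at $f$ replaces them by the white-black edges of $f$. Order the set $\mathcal D_G$ of perfect matchings by $M\le M'$ if $M$ is obtained from $M'$ by a sequence of down-flips. This order has a least element $\hat 0$; every $M\in\mathcal D_G$ is the end of a saturated chain $\hat 0=M_0\lessdot M_1\lessdot\dots\lessdot M_\ell=M$ in which $M_{i-1}$ is the down-flip of $M_i$ at a face $f_i$; and the monomial $\operatorname{mrk}(M)=y_{f_1}\cdots y_{f_\ell}$ does not depend on the chain. Thus the dimer face polynomial $$D_G(\mathbf y)=\sum_{M\in\mathcal D_G}\operatorname{mrk}(M)\in\mathbb Z[y_f : f \text{ a non-infinite face of } G]$$ is well defined. Let $\operatorname{Newton}(D_G)\subset\mathbb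 R^{\mathrm{Faces}(G)}$, where $\mathrm{Faces}(G)$ is the set of non-infinite faces, be its Newton polytope, the convex hull of the exponent vectors of the monomials with nonzero coefficient in $D_G$. Then every point of $\operatorname{Newton}(D_G)$ with integer coordinates is a vertex of $\operatorname{Newton}(D_G)$. -/

import Mathlib

/-- A graph (parallel edges allowed) with vertices `V` and edges `E`, drawn on an oriented closed
surface, given by its rotation system.  Every edge `e` has two *darts* `(e, false)` and `(e, true)`,
one for each direction; `src d` is the vertex that the dart `d` leaves.  The permutation `rot` sends
a dart to the next dart *counterclockwise* around the vertex it leaves. -/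
structure RotationSystem (V E : Type*) where
  src : E × Bool → V
  rot : Equiv.Perm (E × Bool)
  /-- `rot` permutes the darts leaving any given vertex in one single cycle. -/
  sameCycle_rot_iff : ∀ d d' : E × Bool, rot.SameCycle d d' ↔ src d = src d'

namespace RotationSystem

variable {V E : Type*}

/-- Reversing the direction of a dart. -/
def rev : Equiv.Perm (E × Bool) := Equiv.prodCongr (Equiv.refl E) Equiv.boolNot

/-- Walk along the dart `d` and turn right as sharply as possible: this is the next dart on the
boundary of the face that lies on the right-hand side of `d`. -/
def facePerm (G : RotationSystem V E) : Equiv.Perm (E × Bool) := rev.trans G.rot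

/-- The faces of the drawing: the orbits of darts under `facePerm`. -/
def Face (G : RotationSystem V E) : Type _ := Quotient (Equiv.Perm.SameCycle.setoid G.facePerm)

/-- The face on the right-hand side of a dart.  The darts with `G.face d = f` form the boundary walk
of `f`, traversed with `f` on the right, that is, clockwise around `f` if `f` is bounded. -/
def face (G : RotationSystem V E) (d : E × Bool) : G.Face :=
  Quotient.mk (Equiv.Perm.SameCycle.setoid G.facePerm) d

/-- The boundary of `f` is a cycle of the graph: its boundary walk passes through no vertex twice
and through no edge in both directions. -/
def BoundaryIsCycle (G : RotationSystem V E) (f : G.Face) : Prop :=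
  (∀ d d', G.face d = f → G.face d' = f → G.src d = G.src d' → d = d') ∧
    ∀ d, G.face d = f → G.face (rev d) ≠ f

end RotationSystem

/-- A connected plane graph with at least one edge, as a combinatorial map: a connected graph with a
rotation system whose surface is the sphere (Euler characteristic `2`), together with the choice of
the face that contains the point at infinity. -/
structure PlaneGraph (V E : Type*) extends RotationSystem V E where
  connected : ∀ u v : V, Relation.ReflTransGen
    (fun a b => ∃ d, src d = a ∧ src (RotationSystem.rev d) = b) u v
  euler : (Nat.card V : ℤ) - Nat.card E + Nat.card toRotationSystem.Face = 2
  infiniteFace : toRotationSystem.Face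

/-- A connected plane graph with a fixed proper colouring of its vertices: the vertices in `black`
are black, the others are white. -/
structure BipartitePlaneGraph (V E : Type*) extends PlaneGraph V E where
  black : Set V
  proper : ∀ d, src d ∈ black ↔ src (RotationSystem.rev d) ∉ black

namespace BipartitePlaneGraph

variable {V E : Type*}

/-- A perfect matching: a set of edges such that every vertex is an endpoint of exactly one of
them. -/
def IsPerfectMatching (G : BipartitePlaneGraph V E) (M : Set E) : Prop :=
  ∀ v : V, ∃! e : E, e ∈ M ∧ ∃ b : Bool, G.src (e, b) = v

/-- The dimers (perfect matchings) of `G`. -/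
def Dimer (G : BipartitePlaneGraph V E) : Type _ := {M : Set E // G.IsPerfectMatching M}

/-- Property `(*)`: every edge is in some perfect matching.  (Connectedness and bipartiteness are
part of the structure, and finiteness is expressed by finiteness of `V` and `E`.) -/
def HasPropertyStar (G : BipartitePlaneGraph V E) : Prop :=
  ∀ e : E, ∃ M : G.Dimer, e ∈ M.1

/-- The non-infinite faces. -/
def Faces (G : BipartitePlaneGraph V E) : Type _ :=
  {f : G.toRotationSystem.Face // f ≠ G.infiniteFace}

/-- The black-white edges of `f`: going clockwise around `f`, the edge is traversed from its black
to its white endpoint. -/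
def blackWhite (G : BipartitePlaneGraph V E) (f : G.Faces) : Set E :=
  {e | ∃ b : Bool, G.face (e, b) = f.1 ∧ G.src (e, b) ∈ G.black}

/-- The white-black edges of `f`: going clockwise around `f`, the edge is traversed from its white
to its black endpoint. -/
def whiteBlack (G : BipartitePlaneGraph V E) (f : G.Faces) : Set E :=
  {e | ∃ b : Bool, G.face (e, b) = f.1 ∧ G.src (e, b) ∉ G.black}

/-- `M'` is obtained from `M` by the down-flip at `f`: the boundary of `f` is a cycle, `M` contains
all black-white edges of `f`, and they are replaced by the white-black edges of `f`. -/
def DownFlip (G : BipartitePlaneGraph V E) (f : G.Faces) (M M' : G.Dimer) : Prop :=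
  G.BoundaryIsCycle f.1 ∧ G.blackWhite f ⊆ M.1 ∧ M'.1 = (M.1 \ G.blackWhite f) ∪ G.whiteBlack f

/-- `M ≤ M'` if `M` is obtained from `M'` by a sequence of down-flips. -/
instance (G : BipartitePlaneGraph V E) : Preorder G.Dimer where
  le M M' := Relation.ReflTransGen (fun N N' => ∃ f, G.DownFlip f N N') M' M
  le_refl _ := Relation.ReflTransGen.refl
  le_trans _ _ _ h₁ h₂ := Relation.ReflTransGen.trans h₂ h₁

/-- `G.SaturatedChain M₀ M w`: there is a saturated chain `M₀ ⋖ M₁ ⋖ ⋯ ⋖ M_ℓ = M` of dimers in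
which `M_{i-1}` and `M_i` are related by a flip at `f_i`, and whose weight is the monomial
`y_{f_1} ⋯ y_{f_ℓ}` with exponent vector `w`. -/
inductive SaturatedChain (G : BipartitePlaneGraph V E) (M₀ : G.Dimer) :
    G.Dimer → (G.Faces →₀ ℕ) → Prop
  | nil : SaturatedChain G M₀ M₀ 0
  | snoc {M M' : G.Dimer} {w : G.Faces →₀ ℕ} (f : G.Faces) :
      SaturatedChain G M₀ M w → M ⋖ M' → G.DownFlip f M' M →
        SaturatedChain G M₀ M' (w + Finsupp.single f 1)

/-- `p` is the dimer face polynomial `D_G`, the sum of the multivariate ranks of all dimers.  Here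
`bot` is the least element of the dimer lattice, and the multivariate rank of `M`, the monomial with
exponent vector `mrk M`, is the weight of any saturated chain from `bot` to `M`. -/
def IsDimerFacePolynomial (G : BipartitePlaneGraph V E) (p : MvPolynomial G.Faces ℤ) : Prop :=
  ∃ (bot : G.Dimer) (mrk : G.Dimer → (G.Faces →₀ ℕ)),
    (∀ M, bot ≤ M) ∧ (∀ M w, G.SaturatedChain bot M w ↔ w = mrk M) ∧
      p = ∑ᶠ M : G.Dimer, MvPolynomial.monomial (mrk M) (1 : ℤ)

end BipartitePlaneGraph

/-- The Newton polytope of a polynomial with variables indexed by `I`: the convex hull in `ℝ^I` of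
the exponent vectors of its monomials with nonzero coefficient. -/
def newtonPolytope {I : Type*} (p : MvPolynomial I ℤ) : Set (I → ℝ) :=
  convexHull ℝ ((fun (m : I →₀ ℕ) (i : I) => (m i : ℝ)) '' (p.support : Set (I →₀ ℕ)))

/-! The difference of the indicators of two perfect matchings has zero sum at every vertex, so on
the sphere it is the coboundary of an integer function on faces (`exists_coboundary_eq`). Normalised
to vanish at the infinite face, these potentials give each dimer `M` a height `h M`. A down-flip at
`f` lowers the height by 1 at `f` only (`eq_add_of_downFlip`), so `mrk M` is `h M - h bot`. Heights
are closed under pointwise minimum, and the flip order is their pointwise order (`le_of_height_le`,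
`height_le_of_le`); hence the least dimer and a well-defined `D_G`. The coboundary of the exponent
vector of `M` is the indicator of `M` minus that of `bot`, so on each edge the coboundary of a point
of the polytope lies in an interval `[c e, c e + 1]` with `c e` an integer (`exists_bounds`). At an
integer point it is an endpoint of every interval, so both ends of a segment through that point have
the same coboundary. Coboundaries determine points, so the segment is trivial. -/

open Equiv.Perm

/-! ### Darts and faces of a rotation system -/

namespace RotationSystem

variable {V E : Type*}

instance finiteFace [Finite E] (G : RotationSystem V E) : Finite G.Face :=
  inferInstanceAs (Finite (Quotient (Equiv.Perm.SameCycle.setoid G.facePerm)))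

@[simp]
theorem rev_rev (d : E × Bool) : rev (rev d) = d := by
  rcases d with ⟨e, b⟩
  cases b <;> rfl

@[simp]
theorem rev_fst (d : E × Bool) : (rev d).1 = d.1 := rfl

theorem eq_or_eq_rev_of_fst_eq {d d' : E × Bool} (h : d.1 = d'.1) : d = d' ∨ d = rev d' := by
  rcases d with ⟨e, b⟩
  rcases d' with ⟨e', b'⟩
  obtain rfl : e = e' := h
  cases b <;> cases b' <;> simp [rev, Equiv.boolNot]

variable (G : RotationSystem V E)

theorem facePerm_apply (d : E × Bool) : G.facePerm d = G.rot (rev d) := rfl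

theorem face_eq_face_iff {d d' : E × Bool} :
    G.face d = G.face d' ↔ G.facePerm.SameCycle d d' :=
  Quotient.eq (r := Equiv.Perm.SameCycle.setoid G.facePerm)

theorem face_facePerm (d : E × Bool) : G.face (G.facePerm d) = G.face d :=
  (G.face_eq_face_iff).2 (sameCycle_apply_left.2 (SameCycle.refl _ _))

theorem face_rot (d : E × Bool) : G.face (G.rot d) = G.face (rev d) := by
  rw [← G.face_facePerm (rev d), facePerm_apply, rev_rev]

theorem face_surjective : Function.Surjective G.face := fun f => Quotient.exists_rep f

theorem src_rot (d : E × Bool) : G.src (G.rot d) = G.src d :=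
  (G.sameCycle_rot_iff _ _).1 (sameCycle_apply_left.2 (SameCycle.refl _ _))

theorem src_facePerm (d : E × Bool) : G.src (G.facePerm d) = G.src (rev d) := by
  rw [facePerm_apply, src_rot]

theorem exists_rev_src_eq (d : E × Bool) :
    ∃ p, G.face p = G.face d ∧ G.src (rev p) = G.src d := by
  refine ⟨G.facePerm.symm d, ?_, ?_⟩
  · rw [← G.face_facePerm, Equiv.apply_symm_apply]
  · rw [← G.src_facePerm, Equiv.apply_symm_apply]

end RotationSystem

/-! ### Connectedness of the graph and of its dual -/

namespace PlaneGraph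

open RotationSystem

variable {V E : Type*} (G : PlaneGraph V E)

theorem vertex_induction {P : V → Prop} (h : ∀ d, P (G.src d) → P (G.src (rev d)))
    {u : V} (hu : P u) (v : V) : P v := by
  induction G.connected u v with
  | refl => exact hu
  | tail _ hbc ih =>
    obtain ⟨d, rfl, rfl⟩ := hbc
    exact h d ih

/-- Turning by `rot` around a vertex crosses one edge at a time, so `P` spreads to all faces at that
vertex; connectedness carries it to the other vertices. -/
theorem face_induction [Finite E] {P : G.Face → Prop}
    (h : ∀ d, P (G.face d) → P (G.face (rev d))) {f : G.Face} (hf : P f) (g : G.Face) : P g := by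
  have around : ∀ d d', G.src d = G.src d' → P (G.face d) → P (G.face d') := by
    intro d d' hd hP
    obtain ⟨n, -, rfl⟩ := ((G.sameCycle_rot_iff d d').2 hd).exists_pow_eq'
    clear hd
    induction n with
    | zero => exact hP
    | succ n ih =>
      rw [pow_succ', Equiv.Perm.mul_apply, G.face_rot]
      exact h _ ih
  obtain ⟨d, rfl⟩ := G.face_surjective f
  obtain ⟨d', rfl⟩ := G.face_surjective g
  refine G.vertex_induction (P := fun v => ∀ d', G.src d' = v → P (G.face d')) ?_
    (u := G.src d) (fun d' hd' => around d d' hd'.symm hf) (G.src d') d' rfl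
  exact fun a ha d' hd' => around (rev a) d' hd'.symm (h a (ha a rfl))

end PlaneGraph

/-! ### Coboundaries and their exactness on the sphere -/

namespace BipartitePlaneGraph

open RotationSystem

variable {V E : Type*} (G : BipartitePlaneGraph V E)

instance finiteDimer [Finite E] : Finite G.Dimer :=
  inferInstanceAs (Finite {M : Set E // G.IsPerfectMatching M})

instance finiteFaces [Finite E] : Finite G.Faces :=
  inferInstanceAs (Finite {f : G.toRotationSystem.Face // f ≠ G.infiniteFace})

theorem src_rev_ne (d : E × Bool) : G.src (rev d) ≠ G.src d := by
  intro h
  have := G.proper d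
  rw [h] at this
  tauto

theorem eq_of_fst_eq_of_src_eq {d d' : E × Bool} (h : d.1 = d'.1) (hs : G.src d = G.src d') :
    d = d' := by
  rcases eq_or_eq_rev_of_fst_eq h with h | rfl
  · exact h
  · exact absurd hs (G.src_rev_ne d')

open scoped Classical in
/-- The dart of an edge that leaves its black endpoint. -/
noncomputable def blackDart (e : E) : E × Bool :=
  if G.src (e, false) ∈ G.black then (e, false) else (e, true)

@[simp]
theorem blackDart_fst (e : E) : (G.blackDart e).1 = e := by
  unfold blackDart
  split_ifs <;> rfl

theorem src_blackDart_mem (e : E) : G.src (G.blackDart e) ∈ G.black := by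
  unfold blackDart
  split_ifs with h
  · exact h
  · have := G.proper (e, false)
    have h2 : G.src (rev (e, false)) ∈ G.black := by tauto
    exact h2

theorem src_rev_blackDart_notMem (e : E) : G.src (rev (G.blackDart e)) ∉ G.black :=
  (G.proper _).1 (G.src_blackDart_mem e)

theorem blackDart_eq {d : E × Bool} (h : G.src d ∈ G.black) : G.blackDart d.1 = d := by
  rcases eq_or_eq_rev_of_fst_eq (G.blackDart_fst d.1) with h' | h'
  · exact h'
  · exact absurd (h' ▸ G.src_blackDart_mem d.1) ((G.proper d).1 h)

theorem blackDart_eq_rev {d : E × Bool} (h : G.src d ∉ G.black) : G.blackDart d.1 = rev d := by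
  have h' : G.src (rev d) ∈ G.black := by
    have := G.proper d
    tauto
  exact G.blackDart_eq h'

/-- The coboundary of a function on the faces: the value on an edge is the difference of the values
on its two sides, the edge being directed from black to white. -/
noncomputable def coboundary {R : Type*} [Sub R] (x : G.Face → R) (e : E) : R :=
  x (G.face (G.blackDart e)) - x (G.face (rev (G.blackDart e)))

open scoped Classical in
/-- The sum of an edge function over the edges at a vertex. -/
noncomputable def vertexSum [Fintype E] {R : Type*} [AddCommMonoid R] (y : E → R) (v : V) : R :=
  ∑ d with G.src d = v, y d.1

/-- The sum around a vertex telescopes, since `rot d` has on its right the face on the left of `d`.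
All darts at `v` have the same colour, so only a global sign depends on it. -/
theorem vertexSum_coboundary [Fintype E] {R : Type*} [AddCommGroup R] (x : G.Face → R) (v : V) :
    G.vertexSum (G.coboundary x) v = 0 := by
  classical
  have key : ∑ d with G.src d = v, (x (G.face d) - x (G.face (rev d))) = 0 := by
    rw [Finset.sum_sub_distrib, sub_eq_zero]
    symm
    refine Finset.sum_equiv G.rot (fun d => ?_) (fun d _ => ?_)
    · simp [G.src_rot]
    · rw [G.face_rot]
  unfold vertexSum
  by_cases hv : v ∈ G.black
  · rw [← key]
    refine Finset.sum_congr rfl fun d hd => ?_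
    obtain ⟨-, rfl⟩ := Finset.mem_filter.1 hd
    rw [coboundary, G.blackDart_eq hv]
  · rw [← neg_eq_zero, ← key, ← Finset.sum_neg_distrib]
    refine Finset.sum_congr rfl fun d hd => ?_
    obtain ⟨-, rfl⟩ := Finset.mem_filter.1 hd
    rw [coboundary, G.blackDart_eq_rev hv, rev_rev, neg_sub]

theorem eq_of_coboundary_eq_zero [Finite E] {R : Type*} [AddGroup R] {x : G.Face → R}
    (hx : G.coboundary x = 0) (f g : G.Face) : x f = x g := by
  refine (G.face_induction (P := fun g => x f = x g) (fun d hd => ?_) rfl g)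
  rw [hd]
  by_cases h : G.src d ∈ G.black
  · have := congrFun hx d.1
    rw [coboundary, G.blackDart_eq h] at this
    exact sub_eq_zero.1 this
  · have := congrFun hx d.1
    rw [coboundary, G.blackDart_eq_rev h, rev_rev] at this
    exact (sub_eq_zero.1 this).symm

/-- Over a field, an edge function with vanishing vertex sums is a coboundary, because the surface
is a sphere. -/
theorem exists_coboundary_eq_of_field [Finite V] [Fintype E] {K : Type*} [Field K] {y : E → K}
    (hy : ∀ v, G.vertexSum y v = 0) : ∃ x : G.Face → K, G.coboundary x = y := by
  classical
  cases nonempty_fintype V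
  cases nonempty_fintype G.Face
  let δ : (G.Face → K) →ₗ[K] (E → K) :=
    { toFun := G.coboundary
      map_add' := fun a b => by ext e; simp [coboundary]; ring
      map_smul' := fun a b => by ext e; simp [coboundary]; ring }
  let A : Matrix V E K := Matrix.of fun v e => ∑ b : Bool, if G.src (e, b) = v then 1 else 0
  have hA : ∀ z v, A.mulVec z v = G.vertexSum z v := by
    intro z v
    simp only [Matrix.mulVec, dotProduct, A, Matrix.of_apply, vertexSum, Finset.sum_filter,
      Finset.sum_mul, ite_mul, one_mul, zero_mul]
    rw [Fintype.sum_prod_type]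
  have hAt : ∀ z e, A.transpose.mulVec z e = z (G.src (e, false)) + z (G.src (e, true)) := by
    intro z e
    simp only [Matrix.mulVec, dotProduct, Matrix.transpose_apply, A, Matrix.of_apply,
      Fintype.sum_bool, add_mul, ite_mul, one_mul, zero_mul, Finset.sum_add_distrib,
      Finset.sum_ite_eq, Finset.mem_univ, if_true]
    exact add_comm _ _
  have hδ : Module.finrank K (LinearMap.ker δ) ≤ 1 := by
    refine finrank_le_one ⟨fun _ => 1, ?_⟩ ?_
    · rw [LinearMap.mem_ker]; ext e; simp [δ, coboundary]
    · rintro ⟨x, hx⟩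
      refine ⟨x G.infiniteFace, Subtype.ext (funext fun f => ?_)⟩
      simpa using G.eq_of_coboundary_eq_zero (x := x) hx G.infiniteFace f
  obtain ⟨d₀, -⟩ := G.face_surjective G.infiniteFace
  have hadj : ∀ z, A.transpose.mulVec z = 0 → ∀ d, z (G.src (rev d)) = - z (G.src d) := by
    rintro z hz ⟨e, b⟩
    have := congrFun hz e
    rw [hAt, Pi.zero_apply] at this
    cases b
    · exact eq_neg_of_add_eq_zero_right this
    · exact eq_neg_of_add_eq_zero_left this
  -- A kernel element changes sign along every edge, so by connectedness it is a multiple of the ±1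
  -- colouring.
  have hker : Module.finrank K (LinearMap.ker A.transpose.mulVecLin) ≤ 1 := by
    refine finrank_le_one ⟨fun v => if v ∈ G.black then 1 else -1, ?_⟩ ?_
    · rw [LinearMap.mem_ker]
      ext e
      rw [Matrix.mulVecLin_apply, hAt]
      have := G.proper (e, false)
      change _ ↔ G.src (e, true) ∉ G.black at this
      by_cases h : G.src (e, true) ∈ G.black <;> simp [this, h]
    · rintro ⟨z, hz⟩
      have hz' := hadj z hz
      refine ⟨if G.src d₀ ∈ G.black then z (G.src d₀) else - z (G.src d₀),
        Subtype.ext (funext fun v => ?_)⟩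
      refine G.vertex_induction (P := fun v =>
        (if G.src d₀ ∈ G.black then z (G.src d₀) else - z (G.src d₀)) *
          (if v ∈ G.black then 1 else -1) = z v) (fun d hd => ?_) (u := G.src d₀) ?_ v
      · rw [hz' d, ← hd]
        have := G.proper d
        by_cases h : G.src (rev d) ∈ G.black <;> simp [this, h]
      · split_ifs <;> simp
  have r1 := LinearMap.finrank_range_add_finrank_ker δ
  have r2 := LinearMap.finrank_range_add_finrank_ker A.mulVecLin
  have r3 := LinearMap.finrank_range_add_finrank_ker A.transpose.mulVecLin
  have r4 : Module.finrank K (LinearMap.range A.transpose.mulVecLin) =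
      Module.finrank K (LinearMap.range A.mulVecLin) := A.rank_transpose
  rw [Module.finrank_fintype_fun_eq_card] at r1 r2 r3
  have euler := G.euler
  rw [Nat.card_eq_fintype_card, Nat.card_eq_fintype_card, Nat.card_eq_fintype_card] at euler
  have hle : LinearMap.range δ ≤ LinearMap.ker A.mulVecLin := by
    rintro _ ⟨x, rfl⟩
    rw [LinearMap.mem_ker]
    ext v
    rw [Matrix.mulVecLin_apply, hA]
    exact G.vertexSum_coboundary x v
  -- The rank of `δ` is at least `F - 1`, and `dim ker A ≤ E - (V - 1)`, which is `F - 1` by Euler's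
  -- formula.
  have heq := Submodule.eq_of_le_of_finrank_le hle (by omega)
  have hmem : y ∈ LinearMap.ker A.mulVecLin := by
    rw [LinearMap.mem_ker]
    ext v
    rw [Matrix.mulVecLin_apply, hA, hy v, Pi.zero_apply]
  rw [← heq] at hmem
  exact hmem

/-- A rational solution, shifted to vanish at the infinite face, has integer jumps across edges and
so is integral. -/
theorem exists_coboundary_eq [Finite V] [Fintype E] {y : E → ℤ}
    (hy : ∀ v, G.vertexSum y v = 0) :
    ∃ x : G.Face → ℤ, x G.infiniteFace = 0 ∧ G.coboundary x = y := by
  obtain ⟨x, hx⟩ := G.exists_coboundary_eq_of_field (K := ℚ) (y := fun e => (y e : ℚ)) (by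
    intro v
    have := congrArg (Int.cast : ℤ → ℚ) (hy v)
    simpa [vertexSum] using this)
  have hint : ∀ f, ∃ n : ℤ, x f - x G.infiniteFace = n := by
    intro f
    refine G.face_induction (P := fun f => ∃ n : ℤ, x f - x G.infiniteFace = n) ?_
      (f := G.infiniteFace) ⟨0, by simp⟩ f
    rintro d ⟨n, hn⟩
    have he := congrFun hx d.1
    by_cases h : G.src d ∈ G.black
    · rw [coboundary, G.blackDart_eq h] at he
      exact ⟨n - y d.1, by push_cast; linarith⟩
    · rw [coboundary, G.blackDart_eq_rev h, rev_rev] at he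
      exact ⟨n + y d.1, by push_cast; linarith⟩
  choose n hn using hint
  refine ⟨n, ?_, ?_⟩
  · have := hn G.infiniteFace
    rw [sub_self] at this
    exact_mod_cast this.symm
  · ext e
    have he := congrFun hx e
    have h1 := hn (G.face (G.blackDart e))
    have h2 := hn (G.face (rev (G.blackDart e)))
    rw [coboundary] at he ⊢
    have : ((n (G.face (G.blackDart e)) - n (G.face (rev (G.blackDart e))) : ℤ) : ℚ) = y e := by
      push_cast
      linarith
    exact_mod_cast this

end BipartitePlaneGraph

/-! ### Dimers as 0/1 edge functions with vertex sums 1 -/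

namespace BipartitePlaneGraph

open RotationSystem

variable {V E : Type*} {G : BipartitePlaneGraph V E}

namespace Dimer

/-- The indicator function of a dimer. -/
noncomputable def indicator (M : G.Dimer) : E → ℤ := Set.indicator M.1 1

theorem indicator_of_mem {M : G.Dimer} {e : E} (h : e ∈ M.1) : M.indicator e = 1 :=
  Set.indicator_of_mem h _

theorem indicator_of_notMem {M : G.Dimer} {e : E} (h : e ∉ M.1) : M.indicator e = 0 :=
  Set.indicator_of_notMem h _

theorem indicator_eq_one_iff {M : G.Dimer} {e : E} : M.indicator e = 1 ↔ e ∈ M.1 := by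
  by_cases h : e ∈ M.1
  · simp [indicator_of_mem h, h]
  · simp [indicator_of_notMem h, h]

theorem indicator_nonneg (M : G.Dimer) (e : E) : 0 ≤ M.indicator e := by
  by_cases h : e ∈ M.1
  · simp [indicator_of_mem h]
  · simp [indicator_of_notMem h]

theorem indicator_le_one (M : G.Dimer) (e : E) : M.indicator e ≤ 1 := by
  by_cases h : e ∈ M.1
  · simp [indicator_of_mem h]
  · simp [indicator_of_notMem h]

theorem ext_mem {M N : G.Dimer} (h : ∀ e, e ∈ M.1 ↔ e ∈ N.1) : M = N :=
  Subtype.ext (Set.ext h)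

theorem indicator_injective : Function.Injective (indicator : G.Dimer → E → ℤ) := by
  intro M N h
  refine ext_mem fun e => ?_
  rw [← indicator_eq_one_iff, h, indicator_eq_one_iff]

/-- Two edges of a dimer that meet in a vertex coincide. -/
theorem eq_of_src_eq (M : G.Dimer) {d d' : E × Bool} (h : d.1 ∈ M.1) (h' : d'.1 ∈ M.1)
    (hs : G.src d = G.src d') : d = d' :=
  G.eq_of_fst_eq_of_src_eq ((M.2 (G.src d)).unique ⟨h, d.2, rfl⟩ ⟨h', d'.2, hs.symm⟩) hs

theorem vertexSum_indicator [Fintype E] (M : G.Dimer) (v : V) :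
    G.vertexSum M.indicator v = 1 := by
  classical
  obtain ⟨e, ⟨he, b, hb⟩, -⟩ := M.2 v
  unfold vertexSum
  rw [Finset.sum_eq_single (e, b)]
  · exact indicator_of_mem he
  · intro d hd hne
    refine indicator_of_notMem fun hM => hne (M.eq_of_src_eq hM he ?_)
    rw [(Finset.mem_filter.1 hd).2, hb]
  · intro h
    exact absurd (by simpa using hb) h

end Dimer

theorem exists_dimer_of_vertexSum [Fintype E] {y : E → ℤ} (h0 : ∀ e, 0 ≤ y e) (h1 : ∀ e, y e ≤ 1)
    (hy : ∀ v, G.vertexSum y v = 1) : ∃ M : G.Dimer, M.indicator = y := by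
  classical
  have hM : G.IsPerfectMatching {e | y e = 1} := by
    intro v
    have hv := hy v
    have hd : ∀ d : E × Bool, y d.1 = if y d.1 = 1 then 1 else 0 := by
      intro d
      have := h0 d.1
      have := h1 d.1
      split_ifs <;> omega
    unfold vertexSum at hv
    rw [Finset.sum_congr rfl fun d _ => hd d, Finset.sum_boole, Finset.filter_filter] at hv
    obtain ⟨d, hd⟩ := Finset.card_eq_one.1 (by exact_mod_cast hv)
    have hiff : ∀ d', (G.src d' = v ∧ y d'.1 = 1) ↔ d' = d := by
      intro d'
      rw [← Finset.mem_singleton (a := d), ← hd, Finset.mem_filter]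
      simp
    obtain ⟨h2, h3⟩ := (hiff d).2 rfl
    refine ⟨d.1, ⟨h3, d.2, h2⟩, ?_⟩
    rintro e ⟨he, b, hb⟩
    exact congrArg Prod.fst ((hiff (e, b)).1 ⟨hb, he⟩)
  let M : G.Dimer := ⟨_, hM⟩
  refine ⟨M, funext fun e => ?_⟩
  have := h0 e
  have := h1 e
  by_cases h : y e = 1
  · exact (Dimer.indicator_of_mem (M := M) h).trans h.symm
  · rw [Dimer.indicator_of_notMem (M := M) h]
    omega

/-! ### Height functions -/

variable (G) in
/-- A height function assigns to every dimer a potential on the faces, such that the coboundary of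
the difference of two potentials is the difference of the two dimers. -/
structure IsHeight (h : G.Dimer → G.Face → ℤ) : Prop where
  infiniteFace : ∀ M, h M G.infiniteFace = 0
  indicator_sub : ∀ M N e,
    M.indicator e - N.indicator e = G.coboundary (h M) e - G.coboundary (h N) e

variable (G) in
theorem exists_isHeight [Finite V] [Finite E] : ∃ h, G.IsHeight h := by
  cases nonempty_fintype E
  rcases isEmpty_or_nonempty G.Dimer with hE | ⟨⟨N⟩⟩
  · exact ⟨fun _ _ => 0, ⟨fun _ => rfl, fun M => hE.elim M⟩⟩
  have key : ∀ M : G.Dimer, ∃ x : G.Face → ℤ, x G.infiniteFace = 0 ∧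
      G.coboundary x = M.indicator - N.indicator := by
    intro M
    apply G.exists_coboundary_eq
    intro v
    have hM := M.vertexSum_indicator v
    have hN := N.vertexSum_indicator v
    unfold vertexSum at *
    simp [Finset.sum_sub_distrib, hM, hN]
  choose h h0 h1 using key
  refine ⟨h, h0, fun M M' e => ?_⟩
  rw [h1, h1, Pi.sub_apply, Pi.sub_apply]
  ring

/-- An edge meeting `e` lies in some dimer, which also contains `e`, so it equals `e`; by
connectedness `G` is a single edge. -/
theorem eq_of_forall_mem {e : E} (hG : G.HasPropertyStar) (he : ∀ M : G.Dimer, e ∈ M.1) (e' : E) :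
    e' = e := by
  have hsrc : ∀ d b, G.src d = G.src (e, b) → d = (e, b) := by
    intro d b hd
    obtain ⟨M, hM⟩ := hG d.1
    exact M.eq_of_src_eq hM (he M) hd
  obtain ⟨b, hb⟩ := G.vertex_induction (P := fun v => ∃ b, v = G.src (e, b)) (by
    rintro d ⟨b, hb⟩
    rw [hsrc d b hb]
    exact ⟨!b, rfl⟩) ⟨false, rfl⟩ (G.src (e', false))
  exact congrArg Prod.fst (hsrc _ b hb)

namespace IsHeight

variable {h : G.Dimer → G.Face → ℤ}

theorem injective (hh : G.IsHeight h) : Function.Injective h := by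
  intro M N hMN
  refine Dimer.indicator_injective (funext fun e => ?_)
  have := hh.indicator_sub M N e
  rw [hMN] at this
  omega

/-- Adding a coboundary preserves vertex sums, so the 0/1 bounds on edges are the only obstruction
to being a height. -/
theorem exists_eq [Finite E] (hh : G.IsHeight h) (M : G.Dimer) {x : G.Face → ℤ}
    (hx : x G.infiniteFace = 0)
    (h0 : ∀ e, 0 ≤ M.indicator e + G.coboundary x e - G.coboundary (h M) e)
    (h1 : ∀ e, M.indicator e + G.coboundary x e - G.coboundary (h M) e ≤ 1) :
    ∃ N, h N = x := by
  cases nonempty_fintype E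
  obtain ⟨N, hN⟩ := exists_dimer_of_vertexSum (G := G) h0 h1 (by
    intro v
    have hM := M.vertexSum_indicator v
    have hx := G.vertexSum_coboundary x v
    have hm := G.vertexSum_coboundary (h M) v
    unfold vertexSum at *
    rw [Finset.sum_sub_distrib, Finset.sum_add_distrib, hM, hx, hm]
    norm_num)
  refine ⟨N, funext fun f => ?_⟩
  have key := G.eq_of_coboundary_eq_zero (x := h N - x) (by
    ext e
    have h2 := hh.indicator_sub N M e
    rw [hN] at h2
    simp only [coboundary, Pi.sub_apply, Pi.zero_apply] at h2 ⊢
    linarith) f G.infiniteFace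
  rw [Pi.sub_apply, Pi.sub_apply, hh.infiniteFace, hx] at key
  omega

/-- The pointwise minimum of the heights of two dimers is the height of a dimer. -/
theorem exists_inf [Finite E] (hh : G.IsHeight h) (M N : G.Dimer) : ∃ K, h K = h M ⊓ h N := by
  -- The integer function `h M - h N` changes by at most 1 across an edge, so it does not change
  -- strict sign there. Hence the minimum agrees with one of the two heights on both sides.
  refine hh.exists_eq M (by simp [hh.infiniteFace]) (fun e => ?_) (fun e => ?_) <;>
  · have h2 := hh.indicator_sub M N e
    have := M.indicator_nonneg e
    have := N.indicator_nonneg e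
    have := M.indicator_le_one e
    have := N.indicator_le_one e
    simp only [coboundary, Pi.inf_apply] at h2 ⊢
    omega

theorem exists_forall_le [Finite E] [Nonempty G.Dimer] (hh : G.IsHeight h) :
    ∃ K, ∀ M, h K ≤ h M := by
  have hdir : Directed (· ≥ ·) h := fun M N => by
    obtain ⟨K, hK⟩ := hh.exists_inf M N
    exact ⟨K, hK ▸ inf_le_left, hK ▸ inf_le_right⟩
  exact hdir.finite_le id

/-- If both sides of an edge are the same face, then it is the infinite face. -/
theorem eq_infiniteFace [Finite E] (hh : G.IsHeight h) (hG : G.HasPropertyStar) {d : E × Bool}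
    (hd : G.face d = G.face (rev d)) : G.face d = G.infiniteFace := by
  have hb : G.face (G.blackDart d.1) = G.face (rev (G.blackDart d.1)) := by
    rcases eq_or_eq_rev_of_fst_eq (G.blackDart_fst d.1) with h' | h' <;> rw [h']
    · exact hd
    · rw [rev_rev, hd]
  obtain ⟨N, hN⟩ := hG d.1
  -- With equal faces on both sides every coboundary vanishes at this edge, so all dimers agree
  -- there.
  have hall : ∀ M : G.Dimer, d.1 ∈ M.1 := by
    intro M
    have := hh.indicator_sub M N d.1
    rw [coboundary, coboundary, hb, sub_self, sub_self, sub_self, sub_eq_zero,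
      Dimer.indicator_of_mem hN] at this
    exact Dimer.indicator_eq_one_iff.1 this
  obtain ⟨d', hd'⟩ := G.face_surjective G.infiniteFace
  rcases eq_or_eq_rev_of_fst_eq (eq_of_forall_mem hG hall d'.1) with h' | h'
  · rw [← hd', h']
  · rw [← hd', h', hd]

open scoped Classical in
theorem eq_add_of_downFlip [Finite E] (hh : G.IsHeight h) {f : G.Faces} {M M' : G.Dimer}
    (hf : G.DownFlip f M M') (g : G.Face) : h M g = h M' g + (if g = f.1 then 1 else 0) := by
  classical
  obtain ⟨⟨-, hcyc⟩, hbw, hM'⟩ := hf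
  -- The preceding boundary edge is black-white, hence in `M`, and already covers the white vertex.
  have hwb : ∀ d, G.face d = f.1 → G.src d ∉ G.black → d.1 ∉ M.1 := by
    intro d hd hs hdM
    obtain ⟨p, hp, hps⟩ := G.exists_rev_src_eq d
    have hpb : G.src p ∈ G.black := by
      have := G.proper p
      rw [hps] at this
      exact this.2 hs
    have hpM : p.1 ∈ M.1 := hbw ⟨p.2, hp.trans hd, hpb⟩
    have := M.eq_of_src_eq (d := rev p) hpM hdM hps
    rw [← this] at hp hd
    exact hcyc _ hd ((rev_rev p).symm ▸ hp.trans hd)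
  let x : G.Face → ℤ := fun g => if g = f.1 then 1 else 0
  have hx : ∀ e, M.indicator e - M'.indicator e = G.coboundary x e := by
    intro e
    have hbwe : e ∈ G.blackWhite f ↔ G.face (G.blackDart e) = f.1 := by
      constructor
      · rintro ⟨b, hb, hs⟩
        rw [← hb, ← G.blackDart_eq hs]
      · intro hb
        have := G.blackDart_fst e
        refine ⟨(G.blackDart e).2, ?_⟩
        have h3 : (e, (G.blackDart e).2) = G.blackDart e := Prod.ext this.symm rfl
        rw [h3]
        exact ⟨hb, G.src_blackDart_mem e⟩
    have hwbe : e ∈ G.whiteBlack f ↔ G.face (rev (G.blackDart e)) = f.1 := by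
      constructor
      · rintro ⟨b, hb, hs⟩
        rw [← hb, G.blackDart_eq_rev hs, rev_rev]
      · intro hb
        have := G.blackDart_fst e
        refine ⟨(rev (G.blackDart e)).2, ?_⟩
        have h3 : (e, (rev (G.blackDart e)).2) = rev (G.blackDart e) := Prod.ext this.symm rfl
        rw [h3]
        exact ⟨hb, G.src_rev_blackDart_notMem e⟩
    have hmem : e ∈ M'.1 ↔ (e ∈ M.1 ∧ ¬ G.face (G.blackDart e) = f.1) ∨
        G.face (rev (G.blackDart e)) = f.1 := by
      rw [hM', Set.mem_union, Set.mem_sdiff, hbwe, hwbe]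
    have h1 : G.face (G.blackDart e) = f.1 → e ∈ M.1 := fun h => hbw (hbwe.2 h)
    have h2 : G.face (rev (G.blackDart e)) = f.1 → e ∉ M.1 := fun h => by
      have := hwb _ h (G.src_rev_blackDart_notMem e)
      rwa [rev_fst, blackDart_fst] at this
    simp only [Dimer.indicator, Set.indicator_apply, hmem, coboundary, x, Pi.one_apply]
    split_ifs <;> first | rfl | tauto
  have key := G.eq_of_coboundary_eq_zero (x := h M - h M' - x) (by
    ext e
    have h1 := hh.indicator_sub M M' e
    have h2 := hx e
    simp only [coboundary, Pi.sub_apply, Pi.zero_apply] at h1 h2 ⊢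
    linarith) g G.infiniteFace
  have hinf : x G.infiniteFace = 0 := if_neg (Ne.symm f.2)
  simp only [Pi.sub_apply, hh.infiniteFace, hinf] at key
  change h M g = h M' g + x g
  omega

open scoped Classical in
-- Property (*) keeps `f` from lying on both sides of an edge. The boundary then visits no vertex
-- twice, because its black-white edges lie in `M` and its white-black edges in `M'`.
theorem downFlip_of_eq_add [Finite E] (hh : G.IsHeight h) (hG : G.HasPropertyStar) {f : G.Faces}
    {M M' : G.Dimer} (hx : ∀ g, h M g = h M' g + (if g = f.1 then 1 else 0)) :
    G.DownFlip f M M' := by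
  classical
  have hcyc : ∀ d, G.face d = f.1 → G.face (rev d) ≠ f.1 := by
    intro d hd hd'
    exact f.2 (hd ▸ hh.eq_infiniteFace hG (hd.trans hd'.symm))
  have hind : ∀ e, M.indicator e - M'.indicator e = (if G.face (G.blackDart e) = f.1 then 1 else 0)
      - (if G.face (rev (G.blackDart e)) = f.1 then 1 else 0) := by
    intro e
    rw [hh.indicator_sub, coboundary, hx, hx, coboundary]
    ring
  have hblack : ∀ d, G.face d = f.1 → G.src d ∈ G.black → d.1 ∈ M.1 ∧ d.1 ∉ M'.1 := by
    intro d hd hs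
    have := hind d.1
    rw [G.blackDart_eq hs, if_pos hd, if_neg (hcyc d hd)] at this
    have h1 := M.indicator_le_one d.1
    have h2 := M'.indicator_nonneg d.1
    rw [← Dimer.indicator_eq_one_iff, ← Dimer.indicator_eq_one_iff]
    omega
  have hwhite : ∀ d, G.face d = f.1 → G.src d ∉ G.black → d.1 ∈ M'.1 := by
    intro d hd hs
    have := hind d.1
    rw [G.blackDart_eq_rev hs, rev_rev, if_pos hd, if_neg (hcyc d hd)] at this
    have h1 := M'.indicator_le_one d.1
    have h2 := M.indicator_nonneg d.1
    rw [← Dimer.indicator_eq_one_iff]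
    omega
  refine ⟨⟨fun d d' hd hd' hs => ?_, hcyc⟩, ?_, ?_⟩
  · by_cases hb : G.src d ∈ G.black
    · exact M.eq_of_src_eq (hblack d hd hb).1 (hblack d' hd' (hs ▸ hb)).1 hs
    · exact M'.eq_of_src_eq (hwhite d hd hb) (hwhite d' hd' (hs ▸ hb)) hs
  · rintro e ⟨b, hb, hs⟩
    exact (hblack _ hb hs).1
  · ext e
    have key := hind e
    constructor
    · intro he
      by_cases hw : e ∈ G.whiteBlack f
      · exact Or.inr hw
      refine Or.inl ⟨?_, ?_⟩
      · have h2 : ¬ G.face (rev (G.blackDart e)) = f.1 := by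
          intro h2
          refine hw ⟨(rev (G.blackDart e)).2, ?_⟩
          have h3 : (e, (rev (G.blackDart e)).2) = rev (G.blackDart e) :=
            Prod.ext (G.blackDart_fst e).symm rfl
          rw [h3]
          exact ⟨h2, G.src_rev_blackDart_notMem e⟩
        rw [if_neg h2, Dimer.indicator_of_mem he] at key
        have := M.indicator_le_one e
        rw [← Dimer.indicator_eq_one_iff]
        split_ifs at key <;> omega
      · rintro ⟨b, hb, hs⟩
        exact (hblack _ hb hs).2 he
    · rintro (⟨he, hn⟩ | ⟨b, hb, hs⟩)
      · have h2 : ¬ G.face (G.blackDart e) = f.1 := by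
          intro h2
          refine hn ⟨(G.blackDart e).2, ?_⟩
          have h3 : (e, (G.blackDart e).2) = G.blackDart e :=
            Prod.ext (G.blackDart_fst e).symm rfl
          rw [h3]
          exact ⟨h2, G.src_blackDart_mem e⟩
        rw [if_neg h2, Dimer.indicator_of_mem he] at key
        have := M'.indicator_le_one e
        rw [← Dimer.indicator_eq_one_iff]
        split_ifs at key <;> omega
      · exact hwhite _ hb hs

/-- A dimer that is higher than another one has a down-flip that does not go below the other. -/
theorem exists_downFlip [Finite E] (hh : G.IsHeight h) (hG : G.HasPropertyStar) {M N : G.Dimer}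
    {f₀ : G.Face} (hf₀ : h N f₀ < h M f₀) :
    ∃ (f : G.Faces) (M' : G.Dimer), h N f.1 < h M f.1 ∧ G.DownFlip f M M' := by
  classical
  cases nonempty_fintype G.Dimer
  have hMN : M ≠ N := fun hMN => by simp [hMN] at hf₀
  have hout : ∀ e : E, ∃ K : G.Dimer, e ∉ K.1 := by
    intro e
    by_contra! hall
    refine hMN (Dimer.ext_mem fun e' => ?_)
    rw [eq_of_forall_mem hG hall e']
    exact iff_of_true (hall M) (hall N)
  -- Lowering `h M` at a `Φ`-minimal face works: an edge blocking it would lead to a neighbour `g`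
  -- where no summand is larger and one is smaller. The summand for `N` keeps `g` among the
  -- candidates, contradicting minimality.
  let Φ : G.Face → ℤ := fun f => ∑ K, (h K f - h M f)
  obtain ⟨f, hf, hmin⟩ := Set.exists_min_image {f | h N f < h M f} Φ (Set.toFinite _) ⟨f₀, hf₀⟩
  have hfinf : f ≠ G.infiniteFace := by
    rintro rfl
    simp [hh.infiniteFace] at hf
  have hno : ∀ g, (∀ K, h K g - h M g ≤ h K f - h M f) →
      (∃ K, h K g - h M g < h K f - h M f) → False := by
    rintro g hle ⟨K, hK⟩
    have hlt : Φ g < Φ f := Finset.sum_lt_sum (fun K _ => hle K) ⟨K, Finset.mem_univ _, hK⟩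
    have h1 := hle N
    have h2 : h N f < h M f := hf
    exact absurd (hmin g (by change h N g < h M g; omega)) (not_le.2 hlt)
  suffices hlow : ∃ M', h M' = fun g => h M g - if g = f then 1 else 0 by
    obtain ⟨M', hM'⟩ := hlow
    refine ⟨⟨f, hfinf⟩, M', hf, hh.downFlip_of_eq_add hG fun g => ?_⟩
    rw [hM']
    ring
  refine hh.exists_eq M (by simp [hh.infiniteFace, hfinf.symm]) (fun e => ?_) (fun e => ?_)
  -- Blocked at an edge outside `M`: a dimer containing it, given by (*), makes the inequality
  -- strict.
  · by_contra hlt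
    have h0 := M.indicator_nonneg e
    have hr : G.face (G.blackDart e) = f := by
      by_contra hr
      simp only [coboundary, if_neg hr] at hlt
      split_ifs at hlt <;> omega
    have hM : M.indicator e = 0 := by
      simp only [coboundary] at hlt
      split_ifs at hlt <;> omega
    refine hno (G.face (rev (G.blackDart e))) (fun K => ?_) ?_
    · have := hh.indicator_sub K M e
      have := K.indicator_nonneg e
      simp only [coboundary, hr] at *
      omega
    · obtain ⟨K, hK⟩ := hG e
      refine ⟨K, ?_⟩
      have := hh.indicator_sub K M e
      have := Dimer.indicator_of_mem hK
      simp only [coboundary, hr] at *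
      omega
  -- Blocked at an edge of `M`: a dimer avoiding it, from `hout`, makes the inequality strict.
  · by_contra hlt
    have h0 := M.indicator_le_one e
    have hl : G.face (rev (G.blackDart e)) = f := by
      by_contra hl
      simp only [coboundary, if_neg hl] at hlt
      split_ifs at hlt <;> omega
    have hM : M.indicator e = 1 := by
      simp only [coboundary] at hlt
      split_ifs at hlt <;> omega
    refine hno (G.face (G.blackDart e)) (fun K => ?_) ?_
    · have := hh.indicator_sub K M e
      have := K.indicator_le_one e
      simp only [coboundary, hl] at *
      omega
    · obtain ⟨K, hK⟩ := hout e
      refine ⟨K, ?_⟩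
      have := hh.indicator_sub K M e
      have := Dimer.indicator_of_notMem hK
      simp only [coboundary, hl] at *
      omega

/-! ### The flip order and saturated chains in terms of heights -/

theorem le_of_height_le [Finite E] (hh : G.IsHeight h) (hG : G.HasPropertyStar) {M N : G.Dimer}
    (hNM : h N ≤ h M) : N ≤ M := by
  classical
  cases nonempty_fintype G.Face
  induction hn : (∑ f, (h M f - h N f)).toNat using Nat.strong_induction_on generalizing M with
  | _ n ih =>
    by_cases hex : ∃ f, h N f < h M f
    · obtain ⟨f₀, hf₀⟩ := hex
      obtain ⟨f, M', hf, hflip⟩ := hh.exists_downFlip hG hf₀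
      have hM' := hh.eq_add_of_downFlip hflip
      have hNM' : h N ≤ h M' := by
        intro g
        have h1 := hM' g
        have h2 : h N g ≤ h M g := hNM g
        change h N g ≤ h M' g
        split_ifs at h1 with hg
        · subst hg
          change h N f.1 < h M f.1 at hf
          omega
        · omega
      have hlt : ∑ f, (h M' f - h N f) < ∑ f, (h M f - h N f) := by
        refine Finset.sum_lt_sum (fun g _ => ?_) ⟨f.1, Finset.mem_univ _, ?_⟩
        · rw [hM' g]
          split_ifs <;> simp
        · rw [hM' f.1, if_pos rfl]
          simp
      have hnn : 0 ≤ ∑ f, (h M' f - h N f) :=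
        Finset.sum_nonneg fun g _ => sub_nonneg.2 (hNM' g)
      exact Relation.ReflTransGen.head ⟨f, hflip⟩ (ih _ (by omega) hNM' rfl)
    · push Not at hex
      rw [hh.injective (le_antisymm hNM hex)]

theorem height_le_of_le [Finite E] (hh : G.IsHeight h) {M N : G.Dimer} (hNM : N ≤ M)
    (g : G.Face) : h N g ≤ h M g := by
  change Relation.ReflTransGen _ M N at hNM
  induction hNM with
  | refl => exact le_rfl
  | tail _ hflip ih =>
    obtain ⟨f, hflip⟩ := hflip
    have := hh.eq_add_of_downFlip hflip g
    split_ifs at this <;> omega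

theorem covBy_of_downFlip [Finite E] (hh : G.IsHeight h) {f : G.Faces} {M M' : G.Dimer}
    (hflip : G.DownFlip f M M') : M' ⋖ M := by
  have hx := hh.eq_add_of_downFlip hflip
  have hxf := hx f.1
  rw [if_pos rfl] at hxf
  refine ⟨lt_of_le_not_ge (Relation.ReflTransGen.single ⟨f, hflip⟩) fun hle => ?_,
    fun K h1 h2 => ?_⟩
  · have := hh.height_le_of_le hle f.1
    omega
  · have h3 := hh.height_le_of_le h1.le
    have h4 := hh.height_le_of_le h2.le
    have hcase : h K f.1 = h M f.1 ∨ h K f.1 = h M' f.1 := by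
      have := h3 f.1
      have := h4 f.1
      omega
    have hrest : ∀ g, g ≠ f.1 → h K g = h M g ∧ h K g = h M' g := by
      intro g hg
      have h5 := hx g
      rw [if_neg hg] at h5
      have := h3 g
      have := h4 g
      omega
    rcases hcase with hc | hc
    · refine h2.ne (hh.injective (funext fun g => ?_))
      by_cases hg : g = f.1
      · rw [hg, hc]
      · exact (hrest g hg).1
    · refine h1.ne (hh.injective (funext fun g => ?_))
      by_cases hg : g = f.1
      · rw [hg, hc]
      · exact (hrest g hg).2.symm

/-- This makes the weight independent of the chain: it is a difference of heights. -/
theorem eq_add_of_saturatedChain [Finite E] (hh : G.IsHeight h) {M₀ M : G.Dimer} {w : G.Faces →₀ ℕ}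
    (hw : G.SaturatedChain M₀ M w) (f : G.Faces) : h M f.1 = h M₀ f.1 + w f := by
  classical
  induction hw with
  | nil => simp
  | snoc g _ _ hflip ih =>
    rw [hh.eq_add_of_downFlip hflip, ih, Finsupp.add_apply, Finsupp.single_apply]
    have : f.1 = g.1 ↔ g = f := eq_comm.trans Subtype.ext_iff.symm
    simp only [this]
    push_cast
    ring

theorem exists_saturatedChain [Finite E] (hh : G.IsHeight h) {M₀ M : G.Dimer} (hM : M₀ ≤ M) :
    ∃ w, G.SaturatedChain M₀ M w := by
  change Relation.ReflTransGen _ M M₀ at hM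
  induction hM using Relation.ReflTransGen.head_induction_on with
  | refl => exact ⟨0, .nil⟩
  | head hflip _ ih =>
    obtain ⟨f, hflip⟩ := hflip
    obtain ⟨w, hw⟩ := ih
    exact ⟨_, .snoc f hw (hh.covBy_of_downFlip hflip) hflip⟩

end IsHeight

/-! ### Existence and uniqueness of the dimer face polynomial -/

theorem HasPropertyStar.nonempty_dimer (hG : G.HasPropertyStar) : Nonempty G.Dimer := by
  obtain ⟨d, -⟩ := G.face_surjective G.infiniteFace
  obtain ⟨M, -⟩ := hG d.1
  exact ⟨M⟩

theorem existsUnique_isDimerFacePolynomial [Finite V] [Finite E] (hG : G.HasPropertyStar) :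
    ∃! D : MvPolynomial G.Faces ℤ, G.IsDimerFacePolynomial D := by
  obtain ⟨h, hh⟩ := G.exists_isHeight
  have := hG.nonempty_dimer
  obtain ⟨bot, hbot⟩ := hh.exists_forall_le
  have hle : ∀ M, bot ≤ M := fun M => hh.le_of_height_le hG (hbot M)
  choose mrk hmrk using fun M => hh.exists_saturatedChain (hle M)
  refine ⟨_, ⟨bot, mrk, hle, fun M w => ⟨fun hw => ?_, fun hw => hw ▸ hmrk M⟩, rfl⟩, ?_⟩
  · ext f
    have h1 := hh.eq_add_of_saturatedChain hw f
    have h2 := hh.eq_add_of_saturatedChain (hmrk M) f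
    omega
  · rintro _ ⟨bot', mrk', hle', hmrk', rfl⟩
    obtain rfl : bot' = bot :=
      hh.injective (le_antisymm (hh.height_le_of_le (hle' _)) (hh.height_le_of_le (hle _)))
    have : mrk = mrk' := funext fun M => (hmrk' M _).1 (hmrk M)
    rw [this]

/-! ### The Newton polytope -/

/-- The extension by zero of a function on the non-infinite faces to all faces. -/
noncomputable def extendZero (x : G.Faces → ℝ) : G.Face → ℝ :=
  open scoped Classical in fun f => if hf : f ≠ G.infiniteFace then x ⟨f, hf⟩ else 0

theorem extendZero_coe (x : G.Faces → ℝ) (f : G.Faces) : extendZero x f.1 = x f :=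
  dif_pos f.2

theorem extendZero_infiniteFace (x : G.Faces → ℝ) : extendZero x G.infiniteFace = 0 :=
  dif_neg (not_not.2 rfl)

theorem coboundary_extendZero_combo (a b : ℝ) (x y : G.Faces → ℝ) (e : E) :
    G.coboundary (extendZero (a • x + b • y)) e =
      a * G.coboundary (extendZero x) e + b * G.coboundary (extendZero y) e := by
  have key : ∀ f, extendZero (a • x + b • y) f = a * extendZero x f + b * extendZero y f := by
    intro f
    unfold extendZero
    split_ifs
    · rfl
    · simp
  rw [coboundary, coboundary, coboundary, key, key]
  ring

theorem eq_of_coboundary_extendZero_eq [Finite E] {x y : G.Faces → ℝ}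
    (hxy : ∀ e, G.coboundary (extendZero x) e = G.coboundary (extendZero y) e) : x = y := by
  ext f
  have := G.eq_of_coboundary_eq_zero (x := extendZero x - extendZero y) (by
    ext e
    have := hxy e
    simp only [coboundary, Pi.sub_apply, Pi.zero_apply] at this ⊢
    linarith) f.1 G.infiniteFace
  simp only [Pi.sub_apply, extendZero_coe, extendZero_infiniteFace] at this
  linarith

theorem IsDimerFacePolynomial.exists_bounds [Finite V] [Finite E]
    {D : MvPolynomial G.Faces ℤ} (hD : G.IsDimerFacePolynomial D) :
    ∃ c : E → ℤ, ∀ x ∈ newtonPolytope D, ∀ e,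
      c e ≤ G.coboundary (extendZero x) e ∧ G.coboundary (extendZero x) e ≤ c e + 1 := by
  classical
  cases nonempty_fintype G.Dimer
  obtain ⟨h, hh⟩ := G.exists_isHeight
  obtain ⟨bot, mrk, hle, hmrk, rfl⟩ := hD
  refine ⟨fun e => - bot.indicator e, ?_⟩
  let P : Set (G.Faces → ℝ) := {x | ∀ e, ((- bot.indicator e : ℤ) : ℝ) ≤
    G.coboundary (extendZero x) e ∧ G.coboundary (extendZero x) e ≤ ((- bot.indicator e : ℤ) : ℝ) + 1}
  have hconv : Convex ℝ P := by
    intro x hx y hy a b ha hb hab e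
    obtain ⟨hx1, hx2⟩ := hx e
    obtain ⟨hy1, hy2⟩ := hy e
    rw [coboundary_extendZero_combo]
    obtain rfl : b = 1 - a := by linarith
    constructor <;> nlinarith
  refine convexHull_min ?_ hconv
  rintro _ ⟨m, hm, rfl⟩ e
  obtain ⟨M, rfl⟩ : ∃ M, m = mrk M := by
    rw [finsum_eq_sum_of_fintype] at hm
    have hm' := MvPolynomial.support_sum hm
    obtain ⟨M, -, hM⟩ := Finset.mem_biUnion.1 hm'
    exact ⟨M, Finset.mem_singleton.1 (MvPolynomial.support_monomial_subset hM)⟩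
  have hval : ∀ f, extendZero (fun i => (mrk M i : ℝ)) f = ((h M f - h bot f : ℤ) : ℝ) := by
    intro f
    by_cases hf : f = G.infiniteFace
    · rw [hf, extendZero_infiniteFace, hh.infiniteFace, hh.infiniteFace]
      simp
    · have h1 := hh.eq_add_of_saturatedChain ((hmrk M _).2 rfl) ⟨f, hf⟩
      rw [extendZero_coe _ ⟨f, hf⟩, h1]
      simp
  have hcob : G.coboundary (extendZero (fun i => (mrk M i : ℝ))) e =
      ((M.indicator e - bot.indicator e : ℤ) : ℝ) := by
    rw [hh.indicator_sub, coboundary, hval, hval, coboundary, coboundary]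
    push_cast
    ring
  rw [hcob]
  have h0 := M.indicator_nonneg e
  have h1 := M.indicator_le_one e
  constructor
  · exact_mod_cast (by omega : - bot.indicator e ≤ M.indicator e - bot.indicator e)
  · exact_mod_cast (by omega : M.indicator e - bot.indicator e ≤ - bot.indicator e + 1)

end BipartitePlaneGraph

open BipartitePlaneGraph in
theorem corollary3 {V E : Type*} [Finite V] [Finite E] (G : BipartitePlaneGraph V E)
    (hG : G.HasPropertyStar) :
    (∃! D : MvPolynomial G.Faces ℤ, G.IsDimerFacePolynomial D) ∧
      ∀ D : MvPolynomial G.Faces ℤ, G.IsDimerFacePolynomial D →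
        ∀ x ∈ newtonPolytope D, (∀ f, ∃ n : ℤ, x f = n) →
          x ∈ (newtonPolytope D).extremePoints ℝ := by
  refine ⟨existsUnique_isDimerFacePolynomial hG, fun D hD x hx hint => ?_⟩
  obtain ⟨c, hc⟩ := hD.exists_bounds
  have hext : ∀ f, ∃ n : ℤ, extendZero x f = n := by
    intro f
    by_cases hf : f = G.infiniteFace
    · exact ⟨0, by rw [hf, extendZero_infiniteFace, Int.cast_zero]⟩
    · rw [extendZero_coe x ⟨f, hf⟩]
      exact hint _
  refine mem_extremePoints.2 ⟨hx, fun y hy z hz hyz => ?_⟩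
  obtain ⟨a, b, ha, hb, hab, rfl⟩ := hyz
  have key : ∀ e, G.coboundary (extendZero y) e = G.coboundary (extendZero (a • y + b • z)) e ∧
      G.coboundary (extendZero z) e = G.coboundary (extendZero (a • y + b • z)) e := by
    intro e
    obtain ⟨hx1, hx2⟩ := hc _ hx e
    obtain ⟨hy1, hy2⟩ := hc _ hy e
    obtain ⟨hz1, hz2⟩ := hc _ hz e
    obtain ⟨m, hm⟩ := hext (G.face (G.blackDart e))
    obtain ⟨n, hn⟩ := hext (G.face (RotationSystem.rev (G.blackDart e)))
    have hmn : G.coboundary (extendZero (a • y + b • z)) e = ((m - n : ℤ) : ℝ) := by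
      rw [coboundary, hm, hn, Int.cast_sub]
    have hcombo := coboundary_extendZero_combo a b y z e
    rw [hmn] at hx1 hx2 hcombo ⊢
    have h1 : c e ≤ m - n := by exact_mod_cast hx1
    have h2 : m - n ≤ c e + 1 := by exact_mod_cast hx2
    obtain rfl : b = 1 - a := by linarith
    -- A combination with positive weights reaches an end of the interval only if both points do.
    rcases (by omega : m - n = c e ∨ m - n = c e + 1) with h3 | h3
    · rw [h3] at hcombo ⊢
      constructor <;> nlinarith
    · rw [h3, Int.cast_add, Int.cast_one] at hcombo ⊢
      constructor <;> nlinarith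
  exact ⟨eq_of_coboundary_extendZero_eq fun e => (key e).1,
    eq_of_coboundary_extendZero_eq fun e => (key e).2⟩
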